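/- Let $|\cdot|$ and $\langle\cdot,\cdot\rangle$ be the Euclidean norm and inner product. Let $C_{l,Lip}(\mathbb{R}^n)$ be the set of $\varphi:\mathbb{R}^n\to\mathbb{R}$ with $|\varphi(x)-\varphi(y)|\le C(1+|x|^m+|y|^m)|x-y|$ for all $x,y$, for some $C>0$, $m\in\mathbb{N}$ depending on $\varphi$, and $C_{b,Lip}(\mathbb{R}^n)$ the set of bounded Lipschitz functions on $\mathbb{R}^n$. A sublinear expectation space $(\Omega,\mathcal{H},\hat E)$ consists of a set $\Omega$, a linear space $\mathcal{H}$ of real functions on $\Omega$ that contains the constants, contains $|X|$ for every $X\in\mathcal{H}$, and contains $\varphi(X_1,\ldots,X_n)$ whenever $X_1,\ldots,X_n\in\mathcal{H}$ and $\varphi\in C_{l,Lip}(\mathbb{R}^n)$, and a functional $\hat E:\mathcal{H}\to\mathbb{R}$ such that $\hat E[X]\ge\hat E[Y]$ if $X\ge Y$; $\hat E[c]=c$ for constants $c\in\mathbb{R}$; $\hat E[X+Y]\le\hat E[X]+\hat E[Y]$; and $\hat E[\lambda X]=\lambda\hat E[X]$ for $\lambda\ge0$. An $\mathbb{R}^n$-valued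 random variable is an element of $\mathcal{H}^n$. A random vector $Y\in\mathcal{H}^n$ is independent from $X\in\mathcal{H}^m$ if $\hat E[\varphi(X,Y)]=\hat E\big[\hat E[\varphi(x,Y)]|_{x=X}\big]$ for all $\varphi\in C_{l,Lip}(\mathbb{R}^{m+n})$. For a nonempty bounded, convex and closed set $\Gamma\subset\mathbb{R}^d$, an $\mathbb{R}^d$-valued random variable $\eta$ on a sublinear expectation space $(\Omega',\mathcal{H}',\hat E')$ has the maximal distribution $N(\Gamma;0)$ if $\hat E'[\varphi(\eta)]=\max_{y\in\Gamma}\varphi(y)$ for all $\varphi\in C_{b,Lip}(\mathbb{R}^d)$. **Theorem.** Let $\{Y_i\}_{i=1}^\infty$ be a sequence of $\mathbb{R}^d$-valued random variables in a sublinear expectation space $(\Omega,\mathcal{H},\hat E)$ such that (i) $Y_{i+1}$ is independent from $(Y_1,\ldots,Y_i)$ for all $i\ge1$; (ii) there is a constant $M>0$ with $\hat E[|Y_i|^2]\le M$ for all $i\ge1$; (iii) there are a sequence $\{a_n\}_{n\ge1}$ of positive numbers and a function $g:\mathbb{R}^d\to\mathbb{R}$ with $g(p+q)\le g(p)+g(q)$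 and $g(\lambda p)=\lambda g(p)$ for all $p,q\in\mathbb{R}^d$, $\lambda\ge0$, such that $\lim_{n\to\infty}(a_1+\cdots+a_n)/n=0$ and $|\hat E[\langle Y_n,p\rangle]-g(p)|\le a_n|p|$ for all $n\ge1$ and $p\in\mathbb{R}^d$. Then there is a nonempty bounded, convex and closed set $\Gamma\subset\mathbb{R}^d$ with $g(p)=\sup_{q\in\Gamma}\langle p,q\rangle$ for all $p\in\mathbb{R}^d$. For every such $\Gamma$ there is a random vector with the maximal distribution $N(\Gamma;0)$ on some sublinear expectation space, and $S_n/n$, where $S_n=Y_1+\cdots+Y_n$, converges in law to $N(\Gamma;0)$: for every sublinear expectation space $(\Omega',\mathcal{H}',\hat E')$ and every $\eta$ on it with the maximal distribution $N(\Gamma;0)$, $$\lim_{n\to\infty}\hat E\Big[\varphi\Big(\frac{S_n}{n}\Big)\Big]=\hat E'[\varphi(\eta)]\qquad\text{for all }\varphi\in C_{b,Lip}(\mathbb{R}^d).$$ -/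

import Mathlib

open Filter Topology
open scoped RealInnerProductSpace

/-- The class `C_{l,Lip}` of locally Lipschitz functions of polynomial growth on `ℝ^ι`:
`|φ x - φ y| ≤ C (1 + |x|^m + |y|^m) |x - y|` for some `C > 0`, `m ∈ ℕ`, with `|·|` the Euclidean
norm. -/
def IsClLip {ι : Type} [Fintype ι] (φ : EuclideanSpace ℝ ι → ℝ) : Prop :=
  ∃ (C : ℝ) (m : ℕ), 0 < C ∧
    ∀ x y, |φ x - φ y| ≤ C * (1 + ‖x‖ ^ m + ‖y‖ ^ m) * ‖x - y‖

/-- The class `C_{b,Lip}` of bounded Lipschitz functions on `ℝ^ι`. -/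
def IsCbLip {ι : Type} [Fintype ι] (φ : EuclideanSpace ℝ ι → ℝ) : Prop :=
  (∃ B : ℝ, ∀ x, |φ x| ≤ B) ∧ ∃ L : ℝ, ∀ x y, |φ x - φ y| ≤ L * ‖x - y‖

/-- A sublinear expectation space `(Ω, H, E)`. The functional is a map `H → ℝ`; it is written as a
total function on `Ω → ℝ`, but all its properties are required on `H` only, so that its values
outside `H` are arbitrary and carry no information. -/
structure SublinearExpectationSpace (Ω : Type*) where
  /-- the linear space of random variables -/
  H : Submodule ℝ (Ω → ℝ)
  const_mem : ∀ c : ℝ, (fun _ => c) ∈ H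
  abs_mem : ∀ X ∈ H, (fun ω => |X ω|) ∈ H
  comp_mem : ∀ (n : ℕ) (X : Fin n → Ω → ℝ), (∀ i, X i ∈ H) →
    ∀ φ : EuclideanSpace ℝ (Fin n) → ℝ, IsClLip φ →
      (fun ω => φ (WithLp.toLp 2 fun i => X i ω)) ∈ H
  /-- the sublinear expectation -/
  E : (Ω → ℝ) → ℝ
  mono : ∀ X ∈ H, ∀ Y ∈ H, (∀ ω, Y ω ≤ X ω) → E Y ≤ E X
  const : ∀ c : ℝ, E (fun _ => c) = c
  subadd : ∀ X ∈ H, ∀ Y ∈ H, E (fun ω => X ω + Y ω) ≤ E X + E Y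
  pos_homog : ∀ X ∈ H, ∀ c : ℝ, 0 ≤ c → E (fun ω => c * X ω) = c * E X

namespace SublinearExpectationSpace

variable {Ω : Type*} (S : SublinearExpectationSpace Ω)

/-- `X` is a random vector: all its coordinates belong to `H`. -/
def IsRandomVector {ι : Type} (X : Ω → EuclideanSpace ℝ ι) : Prop :=
  ∀ i, (fun ω => X ω i) ∈ S.H

/-- The random vector `Y` is independent from the random vector `X`:
`E[φ(X, Y)] = E[E[φ(x, Y)]|_{x = X}]` for every `φ ∈ C_{l,Lip}`. -/
def IndepFrom {κ ι : Type} [Fintype κ] [Fintype ι]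
    (Y : Ω → EuclideanSpace ℝ ι) (X : Ω → EuclideanSpace ℝ κ) : Prop :=
  ∀ φ : EuclideanSpace ℝ (κ ⊕ ι) → ℝ, IsClLip φ →
    S.E (fun ω => φ (WithLp.toLp 2 (Sum.elim (X ω) (Y ω)))) =
      S.E (fun ω => S.E (fun ω' => φ (WithLp.toLp 2 (Sum.elim (X ω) (Y ω')))))

/-- `η` has the maximal distribution `N(Γ; 0)`: `Γ` is a (nonempty) bounded, convex, closed set and
`E[φ(η)] = max_{y ∈ Γ} φ(y)` for every `φ ∈ C_{b,Lip}`. -/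
def HasMaximalDistribution {ι : Type} [Fintype ι]
    (η : Ω → EuclideanSpace ℝ ι) (Γ : Set (EuclideanSpace ℝ ι)) : Prop :=
  S.IsRandomVector η ∧
    (Γ.Nonempty ∧ Bornology.IsBounded Γ ∧ Convex ℝ Γ ∧ IsClosed Γ) ∧
    ∀ φ : EuclideanSpace ℝ ι → ℝ, IsCbLip φ → IsGreatest (φ '' Γ) (S.E fun ω => φ (η ω))

end SublinearExpectationSpace

/-- `Γ` is a (nonempty) bounded, convex, closed set with support function `g`:
`g(p) = sup_{q ∈ Γ} ⟨p, q⟩`. -/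
def RepresentsSublinear {ι : Type} [Fintype ι]
    (Γ : Set (EuclideanSpace ℝ ι)) (g : EuclideanSpace ℝ ι → ℝ) : Prop :=
  (Γ.Nonempty ∧ Bornology.IsBounded Γ ∧ Convex ℝ Γ ∧ IsClosed Γ) ∧
    ∀ p, IsLUB ((fun q => ⟪p, q⟫) '' Γ) (g p)

/-! The proof is a weak law with a second-moment rate. Write `A n` for the sum of the first `n`
terms of `a`.

Upper bound: `S_n` stays near `nΓ`. If `p` is the vector to `x` from its nearest point in `nΓ`, move
that point by a `q' ∈ Γ` with `⟪p, q'⟫ = g p`. The cross term of the new squared distance is `2(⟪Y,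
p⟫ - g p)`, of expectation at most `2 a n ‖p‖`. Since `‖p‖` is `O(n)` on average, summing gives
`E[dist(S_n, nΓ)²] = O(n A n + n) = o(n²)`.

Lower bound: every `q ∈ Γ` can be approached. As `⟪p, q⟫ ≤ g p`, the same expansion with the
opposite sign of `p` bounds `-E[-‖S_n - nq‖²]` at the same rate; take `q` maximizing `φ` on `Γ`.

A Lipschitz `φ` is compared with these squares by `mul_le_add_sq`. `Γ` comes from Hahn-Banach, and
the maximal distribution from the supremum over `Γ`. -/

/-- Functions whose local Lipschitz constant grows at most linearly: the part of `C_{l,Lip}` with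
exponent one. It contains Lipschitz functions and their squares. -/
def IsLinLip {ι : Type} [Fintype ι] (f : EuclideanSpace ℝ ι → ℝ) : Prop :=
  ∃ C : ℝ, 0 < C ∧ ∀ x y, |f x - f y| ≤ C * (1 + ‖x‖ + ‖y‖) * ‖x - y‖

namespace IsLinLip

variable {ι κ : Type} [Fintype ι] [Fintype κ] {f : EuclideanSpace ℝ ι → ℝ}

theorem isClLip (hf : IsLinLip f) : IsClLip f := by
  obtain ⟨C, hC, h⟩ := hf
  exact ⟨C, 1, hC, by simpa using h⟩

theorem of_lipschitz {L : ℝ} (h : ∀ x y, |f x - f y| ≤ L * ‖x - y‖) : IsLinLip f := by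
  refine ⟨|L| + 1, by positivity, fun x y => (h x y).trans ?_⟩
  gcongr
  have h0 : 0 ≤ |L| * (‖x‖ + ‖y‖) := by positivity
  nlinarith [le_abs_self L, norm_nonneg x, norm_nonneg y]

theorem sq_of_lipschitz {L : ℝ} (h : ∀ x y, |f x - f y| ≤ L * ‖x - y‖) :
    IsLinLip fun x => f x ^ 2 := by
  have hb : ∀ x, |f x| ≤ |f 0| + |L| * ‖x‖ := fun x => by
    have h1 := h x 0
    rw [sub_zero] at h1
    have h2 : L * ‖x‖ ≤ |L| * ‖x‖ := by gcongr; exact le_abs_self L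
    have h3 := abs_sub_abs_le_abs_sub (f x) (f 0)
    linarith
  refine ⟨(2 * |f 0| + |L| + 1) * (|L| + 1), by positivity, fun x y => ?_⟩
  have h1 : |f x + f y| ≤ (2 * |f 0| + |L| + 1) * (1 + ‖x‖ + ‖y‖) := by
    have := abs_add_le (f x) (f y)
    have h0 : 0 ≤ |f 0| * (‖x‖ + ‖y‖) := by positivity
    nlinarith [hb x, hb y, abs_nonneg L, norm_nonneg x, norm_nonneg y]
  have h2 : |f x - f y| ≤ (|L| + 1) * ‖x - y‖ := (h x y).trans (by
    gcongr
    linarith [le_abs_self L])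
  calc |f x ^ 2 - f y ^ 2| = |f x + f y| * |f x - f y| := by rw [← abs_mul]; congr 1; ring
    _ ≤ ((2 * |f 0| + |L| + 1) * (1 + ‖x‖ + ‖y‖)) * ((|L| + 1) * ‖x - y‖) := by gcongr
    _ = _ := by ring

theorem neg (hf : IsLinLip f) : IsLinLip fun x => -f x := by
  obtain ⟨C, hC, h⟩ := hf
  refine ⟨C, hC, fun x y => ?_⟩
  rw [neg_sub_neg, abs_sub_comm]
  exact h x y

theorem comp_clm (hf : IsLinLip f) (T : EuclideanSpace ℝ κ →L[ℝ] EuclideanSpace ℝ ι) :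
    IsLinLip fun x => f (T x) := by
  obtain ⟨C, hC, h⟩ := hf
  refine ⟨C * (1 + ‖T‖) * (1 + ‖T‖), by positivity, fun x y => (h _ _).trans ?_⟩
  have hT : ∀ z, ‖T z‖ ≤ (1 + ‖T‖) * ‖z‖ := fun z =>
    (T.le_opNorm z).trans (by gcongr; linarith)
  rw [← map_sub]
  calc C * (1 + ‖T x‖ + ‖T y‖) * ‖T (x - y)‖
      ≤ C * (1 + (1 + ‖T‖) * ‖x‖ + (1 + ‖T‖) * ‖y‖) * ((1 + ‖T‖) * ‖x - y‖) := by
        gcongr <;> apply hT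
    _ ≤ C * ((1 + ‖T‖) * (1 + ‖x‖ + ‖y‖)) * ((1 + ‖T‖) * ‖x - y‖) := by
        gcongr
        nlinarith [norm_nonneg T]
    _ = _ := by ring

theorem add_const (hf : IsLinLip f) (v : EuclideanSpace ℝ ι) : IsLinLip fun x => f (x + v) := by
  obtain ⟨C, hC, h⟩ := hf
  refine ⟨C * (1 + 2 * ‖v‖), by positivity, fun x y => (h _ _).trans ?_⟩
  rw [add_sub_add_right_eq_sub, mul_assoc C (1 + 2 * ‖v‖)]
  gcongr
  have : 0 ≤ ‖v‖ * (‖x‖ + ‖y‖) := by positivity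
  nlinarith [norm_add_le x v, norm_add_le y v]

end IsLinLip

theorem isLinLip_norm_sub {ι : Type} [Fintype ι] (v : EuclideanSpace ℝ ι) :
    IsLinLip fun x => ‖x - v‖ :=
  .of_lipschitz (L := 1) fun x y => by
    simpa using abs_norm_sub_norm_le (x - v) (y - v)

theorem isLinLip_norm_sub_sq {ι : Type} [Fintype ι] (v : EuclideanSpace ℝ ι) :
    IsLinLip fun x => ‖x - v‖ ^ 2 :=
  .sq_of_lipschitz (L := 1) fun x y => by
    simpa using abs_norm_sub_norm_le (x - v) (y - v)

theorem abs_infDist_sub_infDist_le {E : Type*} [SeminormedAddCommGroup E] (s : Set E) (x y : E) :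
    |Metric.infDist x s - Metric.infDist y s| ≤ 1 * ‖x - y‖ := by
  rw [one_mul, ← dist_eq_norm, ← Real.dist_eq]
  simpa using (Metric.lipschitz_infDist_pt s).dist_le_mul x y

theorem isLinLip_inner {ι : Type} [Fintype ι] (p : EuclideanSpace ℝ ι) :
    IsLinLip fun x => ⟪x, p⟫ :=
  .of_lipschitz (L := ‖p‖) fun x y => by
    rw [← inner_sub_left, mul_comm]
    exact abs_real_inner_le_norm _ _

/-! ### Sublinear expectation calculus and conditioning on partial sums. -/

namespace SublinearExpectationSpace

variable {Ω : Type*} (S : SublinearExpectationSpace Ω)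

theorem E_sub_le {X Y : Ω → ℝ} (hX : X ∈ S.H) (hY : Y ∈ S.H) :
    S.E X - S.E Y ≤ S.E (fun ω => X ω - Y ω) := by
  have := S.subadd _ (S.H.sub_mem hX hY) _ hY
  simp only [Pi.sub_apply, sub_add_cancel] at this
  have h : S.E (X - Y) = S.E (fun ω => X ω - Y ω) := rfl
  linarith

theorem E_add_const_le {X : Ω → ℝ} (hX : X ∈ S.H) (c : ℝ) :
    S.E (fun ω => X ω + c) ≤ S.E X + c := by
  simpa [S.const] using S.subadd _ hX _ (S.const_mem c)

theorem mul_mem {X : Ω → ℝ} (hX : X ∈ S.H) (c : ℝ) : (fun ω => c * X ω) ∈ S.H :=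
  S.H.smul_mem c hX

theorem add_mem {X Y : Ω → ℝ} (hX : X ∈ S.H) (hY : Y ∈ S.H) : (fun ω => X ω + Y ω) ∈ S.H :=
  S.H.add_mem hX hY

/-- Upper bound by an affine expression in two random variables. -/
theorem E_le_of_le_add_mul {Z U V : Ω → ℝ} (hZ : Z ∈ S.H) (hU : U ∈ S.H) (hV : V ∈ S.H)
    {b c : ℝ} (hb : 0 ≤ b) (h : ∀ ω, Z ω ≤ U ω + b * V ω + c) :
    S.E Z ≤ S.E U + b * S.E V + c := by
  have hbV := S.mul_mem hV b
  have h1 := S.mono _ (S.add_mem (S.add_mem hU hbV) (S.const_mem c)) _ hZ h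
  have h2 := S.E_add_const_le (S.add_mem hU hbV) c
  have h3 := S.subadd _ hU _ hbV
  rw [S.pos_homog _ hV b hb] at h3
  linarith

/-- Lower bound by an affine expression in two random variables. -/
theorem le_E_of_sub_mul_le {Z U V : Ω → ℝ} (hZ : Z ∈ S.H) (hU : U ∈ S.H) (hV : V ∈ S.H)
    {b c : ℝ} (hb : 0 ≤ b) (h : ∀ ω, U ω - b * V ω - c ≤ Z ω) :
    S.E U - b * S.E V - c ≤ S.E Z := by
  have := S.E_le_of_le_add_mul hU hZ hV hb (c := c) fun ω => by linarith [h ω]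
  linarith

variable {d : ℕ}

theorem IsRandomVector.comp_mem {X : Ω → EuclideanSpace ℝ (Fin d)} {S : SublinearExpectationSpace Ω}
    (hX : S.IsRandomVector X) {f : EuclideanSpace ℝ (Fin d) → ℝ} (hf : IsLinLip f) :
    (fun ω => f (X ω)) ∈ S.H :=
  S.comp_mem d (fun i ω => X ω i) hX f hf.isClLip

theorem IsRandomVector.sum_range {Y : ℕ → Ω → EuclideanSpace ℝ (Fin d)} {S : SublinearExpectationSpace Ω}
    (hY : ∀ i, S.IsRandomVector (Y i)) (n : ℕ) :
    S.IsRandomVector fun ω => ∑ i ∈ Finset.range n, Y i ω := fun k => by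
  have : (∑ i ∈ Finset.range n, fun ω => Y i ω k) ∈ S.H :=
    S.H.sum_mem fun i _ => hY i k
  convert this using 1
  ext ω
  simp

/-- The expectation of `f (x + Y)` is again a function of `x` of the same class. -/
theorem IsRandomVector.isLinLip_E_add {Y : Ω → EuclideanSpace ℝ (Fin d)} {S : SublinearExpectationSpace Ω}
    (hY : S.IsRandomVector Y) {f : EuclideanSpace ℝ (Fin d) → ℝ} (hf : IsLinLip f) :
    IsLinLip fun x => S.E (fun ω => f (x + Y ω)) := by
  have hmem : ∀ x, (fun ω => f (x + Y ω)) ∈ S.H := fun x => by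
    simpa only [add_comm x] using hY.comp_mem (hf.add_const x)
  have hN : (fun ω => ‖Y ω‖) ∈ S.H := by
    simpa using hY.comp_mem (isLinLip_norm_sub 0)
  obtain ⟨C, hC, h⟩ := hf
  have key : ∀ x y, S.E (fun ω => f (x + Y ω)) - S.E (fun ω => f (y + Y ω)) ≤
      C * (1 + 2 * |S.E fun ω => ‖Y ω‖|) * (1 + ‖x‖ + ‖y‖) * ‖x - y‖ := fun x y => by
    have h1 := S.E_le_of_le_add_mul (hmem x) (hmem y) hN (b := 2 * C * ‖x - y‖)
      (c := C * (1 + ‖x‖ + ‖y‖) * ‖x - y‖) (by positivity) fun ω => by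
        have h2 := le_of_abs_le (h (x + Y ω) (y + Y ω))
        rw [add_sub_add_right_eq_sub] at h2
        have h3 : C * (1 + ‖x + Y ω‖ + ‖y + Y ω‖) * ‖x - y‖ ≤
            C * (1 + (‖x‖ + ‖Y ω‖) + (‖y‖ + ‖Y ω‖)) * ‖x - y‖ := by
          gcongr <;> apply norm_add_le
        linarith
    have h4 : 2 * C * ‖x - y‖ * S.E (fun ω => ‖Y ω‖) ≤
        2 * C * ‖x - y‖ * |S.E fun ω => ‖Y ω‖| := by gcongr; exact le_abs_self _
    have h5 : 0 ≤ 2 * C * ‖x - y‖ * |S.E fun ω => ‖Y ω‖| * (‖x‖ + ‖y‖) := by positivity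
    linarith
  refine ⟨C * (1 + 2 * |S.E fun ω => ‖Y ω‖|), by positivity, fun x y => abs_le.2 ⟨?_, key x y⟩⟩
  have := key y x
  rw [norm_sub_rev, add_right_comm] at this
  linarith

/-- Conditioning on the partial sum of a sequence of successively independent vectors. -/
theorem E_sum_range_succ {Y : ℕ → Ω → EuclideanSpace ℝ (Fin d)}
    (hindep : ∀ i : ℕ, S.IndepFrom (Y (i + 1))
      (fun ω => WithLp.toLp 2 fun k : Fin (i + 1) × Fin d => Y k.1 ω k.2))
    {f : EuclideanSpace ℝ (Fin d) → ℝ} (hf : IsLinLip f) (n : ℕ) :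
    S.E (fun ω => f (∑ i ∈ Finset.range (n + 1), Y i ω)) =
      S.E (fun ω => S.E fun ω' => f ((∑ i ∈ Finset.range n, Y i ω) + Y n ω')) := by
  cases n with
  -- The empty sum is constant, so the first vector needs no independence.
  | zero => simp [S.const]
  | succ n =>
    -- Independence is from the whole past; composing `f` with this linear summation map reduces it
    -- to dependence on the partial sum alone.
    let T : EuclideanSpace ℝ ((Fin (n + 1) × Fin d) ⊕ Fin d) →ₗ[ℝ] EuclideanSpace ℝ (Fin d) :=
      { toFun := fun z => WithLp.toLp 2 fun k => (∑ i, z (.inl (i, k))) + z (.inr k)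
        map_add' := fun x y => by
          ext k
          simp [Finset.sum_add_distrib]
          ring
        map_smul' := fun c x => by
          ext k
          simp [Finset.mul_sum, mul_add] }
    have hT : ∀ ω y, T.toContinuousLinearMap (WithLp.toLp 2 (Sum.elim
        (WithLp.toLp 2 fun k : Fin (n + 1) × Fin d => Y k.1 ω k.2) y)) =
        (∑ i ∈ Finset.range (n + 1), Y i ω) + WithLp.toLp 2 y := fun ω y => by
      ext k
      simp [T, Finset.sum_range (n := n + 1)]
    have := hindep n _ (hf.comp_clm T.toContinuousLinearMap).isClLip
    simp only [hT] at this
    simpa only [Finset.sum_range_succ _ (n + 1)] using this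

end SublinearExpectationSpace

/-! ### Moment bounds and one-step estimates. -/

namespace SublinearExpectationSpace

open scoped Pointwise

variable {Ω : Type*} {S : SublinearExpectationSpace Ω} {d : ℕ}

theorem IsRandomVector.E_norm_le {Y : Ω → EuclideanSpace ℝ (Fin d)} (hY : S.IsRandomVector Y)
    {M : ℝ} (hM : S.E (fun ω => ‖Y ω‖ ^ 2) ≤ M) : S.E (fun ω => ‖Y ω‖) ≤ M + 1 := by
  have h1 : (fun ω => ‖Y ω‖) ∈ S.H := by simpa using hY.comp_mem (isLinLip_norm_sub 0)
  have h2 : (fun ω => ‖Y ω‖ ^ 2) ∈ S.H := by simpa using hY.comp_mem (isLinLip_norm_sub_sq 0)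
  -- From `t ≤ t² + 1`; with `b := 0` the second variable is a dummy.
  have h3 := S.E_le_of_le_add_mul h1 h2 h2 (b := 0) (c := 1) le_rfl fun ω => by
    nlinarith [sq_nonneg (‖Y ω‖ - 1), norm_nonneg (Y ω)]
  linarith

theorem IsRandomVector.E_norm_sub_sq_le {Y : Ω → EuclideanSpace ℝ (Fin d)}
    (hY : S.IsRandomVector Y) {M R : ℝ} (hM : S.E (fun ω => ‖Y ω‖ ^ 2) ≤ M)
    {q : EuclideanSpace ℝ (Fin d)} (hq : ‖q‖ ≤ R) :
    S.E (fun ω => ‖Y ω - q‖ ^ 2) ≤ 2 * M + 2 * R ^ 2 := by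
  have h2 : (fun ω => ‖Y ω‖ ^ 2) ∈ S.H := by simpa using hY.comp_mem (isLinLip_norm_sub_sq 0)
  have h3 := S.E_le_of_le_add_mul (hY.comp_mem (isLinLip_norm_sub_sq q)) h2 h2 (b := 1)
    (c := 2 * R ^ 2) zero_le_one fun ω => by
      have h4 : ‖Y ω - q‖ ^ 2 ≤ (‖Y ω‖ + R) ^ 2 := by
        gcongr
        exact (norm_sub_le _ _).trans (by gcongr)
      linarith [sq_nonneg (‖Y ω‖ - R)]
  linarith

/-- The triangle inequality gives crude linear growth, which suffices because in the recursions this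
quantity is multiplied by `a n`. -/
theorem E_norm_sum_range_sub_le {Y : ℕ → Ω → EuclideanSpace ℝ (Fin d)}
    (hY : ∀ i, S.IsRandomVector (Y i)) {M R : ℝ} (hM : ∀ i, S.E (fun ω => ‖Y i ω‖ ^ 2) ≤ M)
    {q : EuclideanSpace ℝ (Fin d)} (hq : ‖q‖ ≤ R) (n : ℕ) :
    S.E (fun ω => ‖(∑ i ∈ Finset.range n, Y i ω) - (n : ℝ) • q‖) ≤ n * (M + 1 + R) := by
  induction n with
  | zero => simp [S.const]
  | succ n ih =>
    have h1 : (fun ω => ‖Y n ω‖) ∈ S.H := by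
      simpa using (hY n).comp_mem (isLinLip_norm_sub 0)
    have h2 := S.E_le_of_le_add_mul
      ((IsRandomVector.sum_range hY (n + 1)).comp_mem (isLinLip_norm_sub (((n + 1 : ℕ) : ℝ) • q)))
      ((IsRandomVector.sum_range hY n).comp_mem (isLinLip_norm_sub ((n : ℝ) • q)))
      h1 (b := 1) (c := R) zero_le_one fun ω => by
        have : (∑ i ∈ Finset.range (n + 1), Y i ω) - ((n + 1 : ℕ) : ℝ) • q =
            ((∑ i ∈ Finset.range n, Y i ω) - (n : ℝ) • q) + Y n ω - q := by
          rw [Finset.sum_range_succ]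
          push_cast
          module
        rw [this, one_mul]
        exact (norm_sub_le _ _).trans (add_le_add (norm_add_le _ _) hq)
    have h3 := (hY n).E_norm_le (hM n)
    push_cast at h2 ⊢
    linarith

/-- One step of the recursion for the squared distance of the partial sums to the dilates
of `Γ`. -/
theorem IsRandomVector.E_infDist_add_sq_le {Y : Ω → EuclideanSpace ℝ (Fin d)}
    (hY : S.IsRandomVector Y) {M R : ℝ} (hM : S.E (fun ω => ‖Y ω‖ ^ 2) ≤ M)
    {g : EuclideanSpace ℝ (Fin d) → ℝ} {a : ℝ}
    (hg : ∀ p, |S.E (fun ω => ⟪Y ω, p⟫) - g p| ≤ a * ‖p‖)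
    {Γ : Set (EuclideanSpace ℝ (Fin d))} (hΓ : RepresentsSublinear Γ g)
    (hR : ∀ q ∈ Γ, ‖q‖ ≤ R) (n : ℕ) (x : EuclideanSpace ℝ (Fin d)) :
    S.E (fun ω => Metric.infDist (x + Y ω) (((n + 1 : ℕ) : ℝ) • Γ) ^ 2) ≤
      Metric.infDist x ((n : ℝ) • Γ) ^ 2 + 2 * a * Metric.infDist x ((n : ℝ) • Γ) +
        (2 * M + 2 * R ^ 2) := by
  obtain ⟨⟨hne, hbd, hconv, hcl⟩, hlub⟩ := hΓ
  have hcpt : IsCompact Γ := Metric.isCompact_of_isClosed_isBounded hcl hbd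
  obtain ⟨_, ⟨q, hq, rfl⟩, hqx⟩ :=
    (hcpt.smul (n : ℝ)).exists_infDist_eq_dist (hne.smul_set (a := (n : ℝ))) x
  simp only [dist_eq_norm] at hqx
  set p := x - (n : ℝ) • q with hp
  -- The point of `Γ` extremal in direction `p` turns `g p` into an inner product.
  obtain ⟨q', hq', hmax⟩ := hcpt.exists_isMaxOn hne
    (f := fun r => ⟪p, r⟫) (by fun_prop)
  have hgp : g p = ⟪p, q'⟫ := (hlub p).unique
    ⟨by rintro _ ⟨r, hr, rfl⟩; exact hmax hr, fun b hb => hb ⟨q', hq', rfl⟩⟩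
  -- Convexity of `Γ` enters here: `(n + 1)Γ = nΓ + Γ`.
  have hmem : (n : ℝ) • q + q' ∈ ((n + 1 : ℕ) : ℝ) • Γ := by
    push_cast
    rw [hconv.add_smul n.cast_nonneg zero_le_one, one_smul]
    exact Set.add_mem_add (Set.smul_mem_smul_set hq) hq'
  have hf : IsLinLip fun y => Metric.infDist y (((n + 1 : ℕ) : ℝ) • Γ) ^ 2 :=
    .sq_of_lipschitz (abs_infDist_sub_infDist_le _)
  have hZ : (fun ω => Metric.infDist (x + Y ω) (((n + 1 : ℕ) : ℝ) • Γ) ^ 2) ∈ S.H := by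
    simpa only [add_comm x] using hY.comp_mem (hf.add_const x)
  have h1 := S.E_le_of_le_add_mul hZ (hY.comp_mem (isLinLip_norm_sub_sq q'))
    (hY.comp_mem (isLinLip_inner p)) (b := 2) (c := ‖p‖ ^ 2 - 2 * g p) zero_le_two fun ω => by
      have h2 : Metric.infDist (x + Y ω) (((n + 1 : ℕ) : ℝ) • Γ) ≤ ‖(Y ω - q') + p‖ := by
        refine (Metric.infDist_le_dist_of_mem hmem).trans_eq ?_
        rw [dist_eq_norm, hp]
        congr 1
        abel
      have h3 : Metric.infDist (x + Y ω) (((n + 1 : ℕ) : ℝ) • Γ) ^ 2 ≤ ‖(Y ω - q') + p‖ ^ 2 := by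
        gcongr
        exact Metric.infDist_nonneg
      rw [norm_add_sq_real, inner_sub_left, real_inner_comm p q', ← hgp] at h3
      linarith
  have h4 := hY.E_norm_sub_sq_le hM (hR q' hq')
  have h5 := le_of_abs_le (hg p)
  rw [hqx]
  linarith

/-- One step of the recursion for the squared deviation of the partial sums from a fixed
direction `q ∈ Γ`. -/
theorem IsRandomVector.le_E_neg_norm_add_sub_sq {Y : Ω → EuclideanSpace ℝ (Fin d)}
    (hY : S.IsRandomVector Y) {M R : ℝ} (hM : S.E (fun ω => ‖Y ω‖ ^ 2) ≤ M)
    {g : EuclideanSpace ℝ (Fin d) → ℝ} {a : ℝ}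
    (hg : ∀ p, |S.E (fun ω => ⟪Y ω, p⟫) - g p| ≤ a * ‖p‖)
    {q : EuclideanSpace ℝ (Fin d)} (hq : ∀ p, ⟪p, q⟫ ≤ g p)
    (hR : ‖q‖ ≤ R) (n : ℕ) (x : EuclideanSpace ℝ (Fin d)) :
    -‖x - (n : ℝ) • q‖ ^ 2 - 2 * a * ‖x - (n : ℝ) • q‖ - (2 * M + 2 * R ^ 2) ≤
      S.E (fun ω => -‖x + Y ω - ((n + 1 : ℕ) : ℝ) • q‖ ^ 2) := by
  -- The sign is chosen so that `2⟪Y - q, p⟫` appears with a plus in the negated square; its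
  -- expectation is then bounded below using `⟪p, q⟫ ≤ g p`.
  set p := (n : ℝ) • q - x with hp
  have hpx : ‖x - (n : ℝ) • q‖ = ‖p‖ := norm_sub_rev _ _
  have hZ : (fun ω => -‖x + Y ω - ((n + 1 : ℕ) : ℝ) • q‖ ^ 2) ∈ S.H := by
    simpa only [add_comm x] using
      hY.comp_mem ((isLinLip_norm_sub_sq (((n + 1 : ℕ) : ℝ) • q)).add_const x).neg
  have hV := hY.comp_mem (isLinLip_inner p)
  have h1 := S.E_le_of_le_add_mul (S.mul_mem hV 2) hZ (hY.comp_mem (isLinLip_norm_sub_sq q))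
    (b := 1) (c := ‖p‖ ^ 2 + 2 * ⟪p, q⟫) zero_le_one fun ω => by
      have h2 : x + Y ω - ((n + 1 : ℕ) : ℝ) • q = (Y ω - q) - p := by
        rw [hp]
        push_cast
        module
      rw [h2, norm_sub_sq_real (Y ω - q) p, inner_sub_left, real_inner_comm p q]
      linarith
  rw [S.pos_homog _ hV 2 zero_le_two] at h1
  have h4 := hY.E_norm_sub_sq_le hM hR
  have h5 := neg_le_of_abs_le (hg p)
  rw [hpx]
  linarith [hq p]

end SublinearExpectationSpace

/-! ### Summing the recursions and comparison with test functions. -/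

/-- Young's inequality: it trades a Lipschitz error for a square, so second-moment bounds suffice.
-/
theorem mul_le_add_sq {L ε t : ℝ} (hε : 0 < ε) : L * t ≤ ε + L ^ 2 / (4 * ε) * t ^ 2 := by
  have : ε + L ^ 2 / (4 * ε) * t ^ 2 - L * t = (2 * ε - L * t) ^ 2 / (4 * ε) := by
    field_simp
    ring
  have h2 : 0 ≤ (2 * ε - L * t) ^ 2 / (4 * ε) := by positivity
  linarith

/-- The weights `i * a i` are bounded by `n * a i`, leaving the plain sum whose average is
controlled. -/
theorem le_of_recursion {u a : ℕ → ℝ} {C K : ℝ} (hC : 0 ≤ C) (ha : ∀ n, 0 ≤ a n) (h0 : u 0 ≤ 0)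
    (h : ∀ n, u (n + 1) ≤ u n + 2 * a n * (n * C) + K) (n : ℕ) :
    u n ≤ 2 * C * n * ∑ i ∈ Finset.range n, a i + K * n := by
  induction n with
  | zero => simpa using h0
  | succ n ih =>
    have h1 := h n
    have h2 : 0 ≤ C * ∑ i ∈ Finset.range n, a i :=
      mul_nonneg hC (Finset.sum_nonneg fun i _ => ha i)
    have h3 := mul_nonneg hC (ha n)
    rw [Finset.sum_range_succ]
    push_cast
    linarith

namespace SublinearExpectationSpace

open scoped Pointwise

variable {Ω : Type*} {S : SublinearExpectationSpace Ω} {d : ℕ}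

theorem E_infDist_sum_range_sq_le {Y : ℕ → Ω → EuclideanSpace ℝ (Fin d)}
    (hY : ∀ i, S.IsRandomVector (Y i))
    (hindep : ∀ i : ℕ, S.IndepFrom (Y (i + 1))
      (fun ω => WithLp.toLp 2 fun k : Fin (i + 1) × Fin d => Y k.1 ω k.2))
    {M R : ℝ} (hM0 : 0 ≤ M) (hM : ∀ i, S.E (fun ω => ‖Y i ω‖ ^ 2) ≤ M)
    {a : ℕ → ℝ} (ha : ∀ n, 0 ≤ a n) {g : EuclideanSpace ℝ (Fin d) → ℝ}
    (hg : ∀ n p, |S.E (fun ω => ⟪Y n ω, p⟫) - g p| ≤ a n * ‖p‖)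
    {Γ : Set (EuclideanSpace ℝ (Fin d))} (hΓ : RepresentsSublinear Γ g)
    (hR : ∀ q ∈ Γ, ‖q‖ ≤ R) (n : ℕ) :
    S.E (fun ω => Metric.infDist (∑ i ∈ Finset.range n, Y i ω) ((n : ℝ) • Γ) ^ 2) ≤
      2 * (M + 1 + R) * n * ∑ i ∈ Finset.range n, a i + (2 * M + 2 * R ^ 2) * n := by
  obtain ⟨q, hq⟩ := hΓ.1.1
  have hR0 : 0 ≤ R := (norm_nonneg q).trans (hR q hq)
  have hV1 (n : ℕ) := (IsRandomVector.sum_range hY n).comp_mem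
    (.of_lipschitz (abs_infDist_sub_infDist_le ((n : ℝ) • Γ)))
  have hL2 (n : ℕ) : IsLinLip fun x => Metric.infDist x ((n : ℝ) • Γ) ^ 2 :=
    .sq_of_lipschitz (abs_infDist_sub_infDist_le _)
  refine le_of_recursion
    (u := fun n : ℕ => S.E (fun ω => Metric.infDist (∑ i ∈ Finset.range n, Y i ω)
      ((n : ℝ) • Γ) ^ 2)) (by positivity) ha ?_ (fun n => ?_) n
  · have : (0 : EuclideanSpace ℝ (Fin d)) ∈ (0 : ℝ) • Γ := ⟨q, hq, by simp⟩
    simp [S.const, Metric.infDist_zero_of_mem this]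
  · have h1 := S.E_le_of_le_add_mul
      ((IsRandomVector.sum_range hY n).comp_mem ((hY n).isLinLip_E_add (hL2 (n + 1))))
      ((IsRandomVector.sum_range hY n).comp_mem (hL2 n)) (hV1 n)
      (b := 2 * a n) (c := 2 * M + 2 * R ^ 2) (by linarith [ha n])
      fun ω => (hY n).E_infDist_add_sq_le (hM n) (hg n) hΓ hR n _
    rw [← S.E_sum_range_succ hindep (hL2 (n + 1)) n] at h1
    refine h1.trans ?_
    gcongr
    · linarith [ha n]
    -- The distance to `nΓ` is at most the distance to the single point `nq`, which grows linearly.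
    · refine le_trans ?_ (E_norm_sum_range_sub_le hY hM (hR q hq) n)
      refine S.mono _ ((IsRandomVector.sum_range hY n).comp_mem (isLinLip_norm_sub _)) _ (hV1 n)
        fun ω => ?_
      rw [← dist_eq_norm]
      exact Metric.infDist_le_dist_of_mem (Set.smul_mem_smul_set hq)

/-- Only the lower expectation `-E[-·]` of the square can be small: `E` itself also sees the other
points of `Γ`. It is what a lower bound on `E[φ]` needs. -/
theorem neg_E_neg_norm_sum_range_sub_sq_le {Y : ℕ → Ω → EuclideanSpace ℝ (Fin d)}
    (hY : ∀ i, S.IsRandomVector (Y i))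
    (hindep : ∀ i : ℕ, S.IndepFrom (Y (i + 1))
      (fun ω => WithLp.toLp 2 fun k : Fin (i + 1) × Fin d => Y k.1 ω k.2))
    {M R : ℝ} (hM0 : 0 ≤ M) (hM : ∀ i, S.E (fun ω => ‖Y i ω‖ ^ 2) ≤ M)
    {a : ℕ → ℝ} (ha : ∀ n, 0 ≤ a n) {g : EuclideanSpace ℝ (Fin d) → ℝ}
    (hg : ∀ n p, |S.E (fun ω => ⟪Y n ω, p⟫) - g p| ≤ a n * ‖p‖)
    {q : EuclideanSpace ℝ (Fin d)} (hq : ∀ p, ⟪p, q⟫ ≤ g p)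
    (hR : ‖q‖ ≤ R) (n : ℕ) :
    -S.E (fun ω => -‖(∑ i ∈ Finset.range n, Y i ω) - (n : ℝ) • q‖ ^ 2) ≤
      2 * (M + 1 + R) * n * ∑ i ∈ Finset.range n, a i + (2 * M + 2 * R ^ 2) * n := by
  have hR0 : 0 ≤ R := (norm_nonneg q).trans hR
  have hL2 (n : ℕ) : IsLinLip fun x => -‖x - (n : ℝ) • q‖ ^ 2 :=
    (isLinLip_norm_sub_sq _).neg
  refine le_of_recursion
    (u := fun n : ℕ => -S.E (fun ω => -‖(∑ i ∈ Finset.range n, Y i ω) - (n : ℝ) • q‖ ^ 2))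
    (by positivity) ha (by simp [S.const]) (fun n => ?_) n
  have h1 := S.le_E_of_sub_mul_le
    ((IsRandomVector.sum_range hY n).comp_mem ((hY n).isLinLip_E_add (hL2 (n + 1))))
    ((IsRandomVector.sum_range hY n).comp_mem (hL2 n))
    ((IsRandomVector.sum_range hY n).comp_mem (isLinLip_norm_sub ((n : ℝ) • q)))
    (b := 2 * a n) (c := 2 * M + 2 * R ^ 2) (by linarith [ha n])
    fun ω => (hY n).le_E_neg_norm_add_sub_sq (hM n) (hg n) hq hR n _
  rw [← S.E_sum_range_succ hindep (hL2 (n + 1)) n] at h1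
  have h2 := mul_le_mul_of_nonneg_left (E_norm_sum_range_sub_le hY hM hR n)
    (by linarith [ha n] : 0 ≤ 2 * a n)
  linarith

theorem E_comp_average_le {X : Ω → EuclideanSpace ℝ (Fin d)} (hX : S.IsRandomVector X)
    {Γ : Set (EuclideanSpace ℝ (Fin d))} (hne : Γ.Nonempty) (hcpt : IsCompact Γ)
    {φ : EuclideanSpace ℝ (Fin d) → ℝ} {L : ℝ} (hL : ∀ x y, |φ x - φ y| ≤ L * ‖x - y‖)
    {m : ℝ} (hm : ∀ q ∈ Γ, φ q ≤ m) {ε : ℝ} (hε : 0 < ε) {n : ℕ} (hn : n ≠ 0) :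
    S.E (fun ω => φ ((n : ℝ)⁻¹ • X ω)) ≤ m + ε +
      L ^ 2 / (4 * ε) * (S.E (fun ω => Metric.infDist (X ω) ((n : ℝ) • Γ) ^ 2) / (n : ℝ) ^ 2) := by
  have hn' : (n : ℝ) ≠ 0 := Nat.cast_ne_zero.2 hn
  have h1 := S.E_le_of_le_add_mul
    (hX.comp_mem ((IsLinLip.of_lipschitz hL).comp_clm
      ((n : ℝ)⁻¹ • ContinuousLinearMap.id ℝ (EuclideanSpace ℝ (Fin d)))))
    (S.const_mem m)
    (hX.comp_mem (.sq_of_lipschitz (abs_infDist_sub_infDist_le ((n : ℝ) • Γ))))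
    (b := L ^ 2 / (4 * ε) / (n : ℝ) ^ 2) (c := ε) (by positivity) fun ω => by
      obtain ⟨_, ⟨q, hq, rfl⟩, hqx⟩ :=
        (hcpt.smul (n : ℝ)).exists_infDist_eq_dist (hne.smul_set (a := (n : ℝ))) (X ω)
      have h2 := le_of_abs_le (hL ((n : ℝ)⁻¹ • X ω) q)
      have h3 : (n : ℝ)⁻¹ • X ω - q = (n : ℝ)⁻¹ • (X ω - (n : ℝ) • q) := by
        rw [smul_sub, inv_smul_smul₀ hn']
      rw [h3] at h2
      have h4 := mul_le_add_sq (L := L) (t := ‖(n : ℝ)⁻¹ • (X ω - (n : ℝ) • q)‖) hε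
      have h5 : L ^ 2 / (4 * ε) * ‖(n : ℝ)⁻¹ • (X ω - (n : ℝ) • q)‖ ^ 2 =
          L ^ 2 / (4 * ε) / (n : ℝ) ^ 2 * Metric.infDist (X ω) ((n : ℝ) • Γ) ^ 2 := by
        simp only [hqx, norm_smul, dist_eq_norm, norm_inv, RCLike.norm_natCast]
        ring
      have h6 := hm q hq
      simp only [smul_apply, ContinuousLinearMap.id_apply]
      linarith
  rw [S.const] at h1
  simp only [smul_apply, ContinuousLinearMap.id_apply] at h1
  refine h1.trans_eq ?_
  ring

theorem le_E_comp_average {X : Ω → EuclideanSpace ℝ (Fin d)} (hX : S.IsRandomVector X)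
    {φ : EuclideanSpace ℝ (Fin d) → ℝ} {L : ℝ} (hL : ∀ x y, |φ x - φ y| ≤ L * ‖x - y‖)
    (q : EuclideanSpace ℝ (Fin d)) {ε : ℝ} (hε : 0 < ε) {n : ℕ} (hn : n ≠ 0) :
    φ q - ε - L ^ 2 / (4 * ε) * (-S.E (fun ω => -‖X ω - (n : ℝ) • q‖ ^ 2) / (n : ℝ) ^ 2) ≤
      S.E (fun ω => φ ((n : ℝ)⁻¹ • X ω)) := by
  have hn' : (n : ℝ) ≠ 0 := Nat.cast_ne_zero.2 hn
  have hb : 0 ≤ L ^ 2 / (4 * ε) / (n : ℝ) ^ 2 := by positivity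
  have hW := hX.comp_mem (isLinLip_norm_sub_sq ((n : ℝ) • q)).neg
  have h1 := S.mono _ (hX.comp_mem ((IsLinLip.of_lipschitz hL).comp_clm
      ((n : ℝ)⁻¹ • ContinuousLinearMap.id ℝ (EuclideanSpace ℝ (Fin d))))) _
    (S.add_mem (S.const_mem (φ q - ε)) (S.mul_mem hW (L ^ 2 / (4 * ε) / (n : ℝ) ^ 2)))
    fun ω => by
      have h2 := neg_le_of_abs_le (hL ((n : ℝ)⁻¹ • X ω) q)
      have h3 : (n : ℝ)⁻¹ • X ω - q = (n : ℝ)⁻¹ • (X ω - (n : ℝ) • q) := by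
        rw [smul_sub, inv_smul_smul₀ hn']
      rw [h3] at h2
      have h4 := mul_le_add_sq (L := L) (t := ‖(n : ℝ)⁻¹ • (X ω - (n : ℝ) • q)‖) hε
      have h5 : L ^ 2 / (4 * ε) * ‖(n : ℝ)⁻¹ • (X ω - (n : ℝ) • q)‖ ^ 2 =
          L ^ 2 / (4 * ε) / (n : ℝ) ^ 2 * ‖X ω - (n : ℝ) • q‖ ^ 2 := by
        simp only [norm_smul, norm_inv, RCLike.norm_natCast]
        ring
      simp only [smul_apply, ContinuousLinearMap.id_apply]
      linarith
  -- Subtracting a constant makes subadditivity yield a lower bound for the expectation of a sum.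
  have h6 := S.E_sub_le (S.mul_mem hW (L ^ 2 / (4 * ε) / (n : ℝ) ^ 2)) (S.const_mem (-(φ q - ε)))
  rw [S.const, S.pos_homog _ hW _ hb] at h6
  simp only [smul_apply, ContinuousLinearMap.id_apply] at h1
  have h7 : (fun ω => L ^ 2 / (4 * ε) / (n : ℝ) ^ 2 * -‖X ω - (n : ℝ) • q‖ ^ 2 - -(φ q - ε)) =
      fun ω => φ q - ε + L ^ 2 / (4 * ε) / (n : ℝ) ^ 2 * -‖X ω - (n : ℝ) • q‖ ^ 2 := by
    ext ω
    ring
  rw [h7] at h6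
  refine le_trans (le_of_eq ?_) (h6.trans h1)
  ring

end SublinearExpectationSpace

/-! ### Existence of `Γ` and of the maximal distribution. -/

/-- A real sublinear functional is the maximum of the linear functionals that it dominates. -/
theorem exists_inner_le_and_eq_of_sublinear {E : Type*} [NormedAddCommGroup E]
    [InnerProductSpace ℝ E] [FiniteDimensional ℝ E] {g : E → ℝ}
    (hg_add : ∀ p q, g (p + q) ≤ g p + g q) (hg_hom : ∀ (c : ℝ) (p), 0 ≤ c → g (c • p) = c * g p)
    (p : E) : ∃ q : E, (∀ x, ⟪x, q⟫ ≤ g x) ∧ ⟪p, q⟫ = g p := by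
  have g0 : g 0 = 0 := by simpa using hg_hom 0 0 le_rfl
  have H : ∀ c : ℝ, c • p = 0 → c • g p = 0 := fun c hc => by
    rcases smul_eq_zero.1 hc with rfl | rfl <;> simp [g0]
  let f : E →ₗ.[ℝ] ℝ := LinearPMap.mkSpanSingleton' (σ := RingHom.id ℝ) p (g p) H
  obtain ⟨l, hl, hle⟩ := exists_extension_of_le_sublinear f g (fun c hc x => hg_hom c x hc.le) hg_add (by
      rintro ⟨x, hx⟩
      obtain ⟨c, rfl⟩ := Submodule.mem_span_singleton.1 hx
      rw [LinearPMap.mkSpanSingleton'_apply, smul_eq_mul]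
      rcases le_total 0 c with hc | hc
      -- For `c < 0` below, `0 = g 0 ≤ g (c • p) + (-c) * g p`.
      · exact (hg_hom c p hc).ge
      · have h1 := hg_add (c • p) ((-c) • p)
        rw [← add_smul, add_neg_cancel, zero_smul, g0, hg_hom (-c) p (by linarith)] at h1
        change c * g p ≤ g (c • p)
        linarith)
  have hinner : ∀ x, ⟪x, (InnerProductSpace.toDual ℝ E).symm l.toContinuousLinearMap⟫ = l x :=
    fun x => by
      rw [real_inner_comm, InnerProductSpace.toDual_symm_apply]
      rfl
  refine ⟨(InnerProductSpace.toDual ℝ E).symm l.toContinuousLinearMap,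
    fun x => (hinner x).trans_le (hle x), ?_⟩
  have hp : p ∈ f.domain := Submodule.mem_span_singleton_self p
  rw [hinner, hl ⟨p, hp⟩]
  exact LinearPMap.mkSpanSingleton'_apply_self p (g p) H hp

/-- `Γ` is the set of all linear functionals dominated by `g`; testing `q ∈ Γ` against itself bounds
it. -/
theorem exists_representsSublinear {ι : Type} [Fintype ι] {g : EuclideanSpace ℝ ι → ℝ}
    (hg_add : ∀ p q, g (p + q) ≤ g p + g q) (hg_hom : ∀ (c : ℝ) (p), 0 ≤ c → g (c • p) = c * g p)
    {C : ℝ} (hC : ∀ p, g p ≤ C * ‖p‖) : ∃ Γ, RepresentsSublinear Γ g := by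
  have key := exists_inner_le_and_eq_of_sublinear hg_add hg_hom
  refine ⟨{q | ∀ x, ⟪x, q⟫ ≤ g x}, ⟨?_, ?_, ?_, ?_⟩, fun p => ⟨?_, ?_⟩⟩
  · obtain ⟨q, hq, -⟩ := key 0
    exact ⟨q, hq⟩
  · refine (Metric.isBounded_closedBall (x := 0) (r := |C|)).subset fun q hq => ?_
    rw [mem_closedBall_zero_iff]
    have h1 : ‖q‖ * ‖q‖ ≤ C * ‖q‖ := by
      rw [← real_inner_self_eq_norm_mul_norm]
      exact (hq q).trans (hC q)
    rcases (norm_nonneg q).eq_or_lt with h | h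
    · rw [← h]
      positivity
    · exact (le_of_mul_le_mul_right h1 h).trans (le_abs_self C)
  · intro q hq r hr s t hs ht hst x
    rw [inner_add_right, inner_smul_right, inner_smul_right]
    calc s * ⟪x, q⟫ + t * ⟪x, r⟫ ≤ s * g x + t * g x := by
          gcongr
          exacts [hq x, hr x]
      _ = g x := by rw [← add_mul, hst, one_mul]
  · rw [Set.ofPred_forall]
    exact isClosed_iInter fun x => isClosed_le (by fun_prop) continuous_const
  · rintro _ ⟨q, hq, rfl⟩
    exact hq p
  · intro b hb
    obtain ⟨q, hq, hqp⟩ := key p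
    exact hqp ▸ hb ⟨q, hq, rfl⟩

theorem IsClLip.continuous {ι : Type} [Fintype ι] {φ : EuclideanSpace ℝ ι → ℝ} (hφ : IsClLip φ) :
    Continuous φ := by
  obtain ⟨C, m, -, h⟩ := hφ
  refine continuous_iff_continuousAt.2 fun x => tendsto_iff_dist_tendsto_zero.2 ?_
  have hlim : Tendsto (fun y => C * (1 + ‖y‖ ^ m + ‖x‖ ^ m) * ‖y - x‖) (𝓝 x) (𝓝 0) := by
    have : Continuous fun y => C * (1 + ‖y‖ ^ m + ‖x‖ ^ m) * ‖y - x‖ := by fun_prop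
    simpa using this.tendsto x
  exact squeeze_zero (fun _ => dist_nonneg) (fun y => by simpa [Real.dist_eq] using h y x) hlim

/-- The continuous functions on a nonempty compact space, with the supremum as sublinear
expectation. -/
noncomputable def supExpectationSpace (K : Type*) [TopologicalSpace K] [CompactSpace K]
    [Nonempty K] : SublinearExpectationSpace K where
  H :=
    { carrier := {f | Continuous f}
      add_mem' := Continuous.add
      zero_mem' := continuous_zero
      smul_mem' := fun c _ hf => hf.const_smul c }
  const_mem _ := continuous_const
  abs_mem _ hX := continuous_abs.comp hX
  comp_mem n X hX φ hφ := by
    have hX' : ∀ i, Continuous (X i) := hX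
    exact hφ.continuous.comp (by fun_prop)
  E f := ⨆ x, f x
  mono X hX _ _ h := ciSup_mono (isCompact_range hX).bddAbove h
  const _ := ciSup_const
  subadd X hX Y hY := ciSup_le fun x =>
    add_le_add (le_ciSup (isCompact_range hX).bddAbove x) (le_ciSup (isCompact_range hY).bddAbove x)
  pos_homog _ _ _ hc := (Real.mul_iSup_of_nonneg hc _).symm

theorem exists_hasMaximalDistribution {ι : Type} [Fintype ι] {Γ : Set (EuclideanSpace ℝ ι)}
    (hΓ : Γ.Nonempty ∧ Bornology.IsBounded Γ ∧ Convex ℝ Γ ∧ IsClosed Γ) :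
    ∃ (Ω : Type) (S : SublinearExpectationSpace Ω) (η : Ω → EuclideanSpace ℝ ι),
      S.HasMaximalDistribution η Γ := by
  have hcpt : IsCompact Γ := Metric.isCompact_of_isClosed_isBounded hΓ.2.2.2 hΓ.2.1
  have : CompactSpace Γ := isCompact_iff_compactSpace.1 hcpt
  have : Nonempty Γ := hΓ.1.to_subtype
  refine ⟨Γ, supExpectationSpace Γ, Subtype.val, fun i => ?_, hΓ, fun φ hφ => ?_⟩
  · change Continuous fun x : Γ => x.1 i
    fun_prop
  · obtain ⟨-, L, hL⟩ := hφ
    have hc : Continuous fun x : Γ => φ x :=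
      (IsLinLip.of_lipschitz hL).isClLip.continuous.comp continuous_subtype_val
    have h := (isCompact_range hc).isGreatest_sSup (Set.range_nonempty _)
    rwa [Set.image_eq_range]

/-! ### Passage to the limit. -/

theorem tendsto_average_rate {a : ℕ → ℝ}
    (ha_lim : Tendsto (fun n : ℕ => (∑ i ∈ Finset.range n, a i) / (n : ℝ)) atTop (𝓝 0))
    (C K : ℝ) :
    Tendsto (fun n : ℕ => (C * n * ∑ i ∈ Finset.range n, a i + K * n) / (n : ℝ) ^ 2) atTop
      (𝓝 0) := by
  have h : Tendsto (fun n : ℕ => C * ((∑ i ∈ Finset.range n, a i) / (n : ℝ)) + K / (n : ℝ)) atTop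
      (𝓝 0) := by
    simpa using (ha_lim.const_mul C).add (tendsto_const_div_atTop_nhds_zero_nat K)
  refine h.congr' ?_
  filter_upwards [eventually_ne_atTop 0] with n hn
  have : (n : ℝ) ≠ 0 := Nat.cast_ne_zero.2 hn
  field_simp

theorem tendsto_of_forall_abs_sub_le {x r : ℕ → ℝ} {m L : ℝ} (hr : Tendsto r atTop (𝓝 0))
    (h : ∀ ε > 0, ∀ n ≠ 0, |x n - m| ≤ ε + L ^ 2 / (4 * ε) * r n) : Tendsto x atTop (𝓝 m) := by
  refine Metric.tendsto_atTop'.2 fun δ hδ => ?_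
  have h1 : Tendsto (fun n => δ / 2 + L ^ 2 / (4 * (δ / 2)) * r n) atTop (𝓝 (δ / 2)) := by
    simpa using (hr.const_mul (L ^ 2 / (4 * (δ / 2)))).const_add (δ / 2)
  obtain ⟨N, hN⟩ := eventually_atTop.1 (h1.eventually_lt_const (half_lt_self hδ))
  refine ⟨N, fun n hn => ?_⟩
  rw [Real.dist_eq]
  -- Here `ε = δ / 2` is fixed before `n` grows; the strict `N < n` ensures `n ≠ 0`.
  exact (h _ (half_pos hδ) n (by omega)).trans_lt (hN n hn.le)

theorem theorem5p4 {Ω : Type*} (S : SublinearExpectationSpace Ω) (d : ℕ)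
    (Y : ℕ → Ω → EuclideanSpace ℝ (Fin d))
    (hY : ∀ i, S.IsRandomVector (Y i))
    (hindep : ∀ i : ℕ, S.IndepFrom (Y (i + 1))
      (fun ω => WithLp.toLp 2 fun k : Fin (i + 1) × Fin d => Y k.1 ω k.2))
    (M : ℝ) (hM : 0 < M) (hmoment : ∀ i, S.E (fun ω => ‖Y i ω‖ ^ 2) ≤ M)
    (a : ℕ → ℝ) (ha : ∀ n, 0 < a n)
    (ha_lim : Tendsto (fun n : ℕ => (∑ i ∈ Finset.range n, a i) / (n : ℝ)) atTop (𝓝 0))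
    (g : EuclideanSpace ℝ (Fin d) → ℝ)
    (hg_add : ∀ p q, g (p + q) ≤ g p + g q)
    (hg_hom : ∀ (c : ℝ) (p), 0 ≤ c → g (c • p) = c * g p)
    (hg : ∀ n p, |S.E (fun ω => ⟪Y n ω, p⟫) - g p| ≤ a n * ‖p‖) :
    (∃ Γ : Set (EuclideanSpace ℝ (Fin d)), RepresentsSublinear Γ g) ∧
    ∀ Γ : Set (EuclideanSpace ℝ (Fin d)), RepresentsSublinear Γ g →
      (∃ (Ω' : Type) (S' : SublinearExpectationSpace Ω') (η : Ω' → EuclideanSpace ℝ (Fin d)),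
        S'.HasMaximalDistribution η Γ) ∧
      ∀ (Ω' : Type*) (S' : SublinearExpectationSpace Ω') (η : Ω' → EuclideanSpace ℝ (Fin d)),
        S'.HasMaximalDistribution η Γ →
        ∀ φ : EuclideanSpace ℝ (Fin d) → ℝ, IsCbLip φ →
          Tendsto (fun n : ℕ => S.E (fun ω => φ ((n : ℝ)⁻¹ • ∑ i ∈ Finset.range n, Y i ω)))
            atTop (𝓝 (S'.E (fun ω' => φ (η ω')))) := by
  refine ⟨?_, fun Γ hΓ => ⟨exists_hasMaximalDistribution hΓ.1, fun Ω' S' η hη φ hφ => ?_⟩⟩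
  -- The constant comes from the first vector: `g p ≤ E⟪Y 0, p⟫ + a 0 * ‖p‖` and `E‖Y 0‖ ≤ M + 1`.
  · refine exists_representsSublinear hg_add hg_hom (C := a 0 + (M + 1)) fun p => ?_
    have h1 : (fun ω => ‖Y 0 ω‖) ∈ S.H := by simpa using (hY 0).comp_mem (isLinLip_norm_sub 0)
    have h2 := S.E_le_of_le_add_mul ((hY 0).comp_mem (isLinLip_inner p)) (S.const_mem 0) h1
      (b := ‖p‖) (c := 0) (norm_nonneg p) fun ω => by
        linarith [real_inner_le_norm (Y 0 ω) p]
    rw [S.const] at h2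
    have h3 := mul_le_mul_of_nonneg_left ((hY 0).E_norm_le (hmoment 0)) (norm_nonneg p)
    have h4 := neg_le_of_abs_le (hg 0 p)
    linarith
  -- The law of `η` supplies both a maximizer `q` of `φ` on `Γ` for the lower bound and the bound on
  -- `φ` over `Γ` for the upper one.
  · obtain ⟨⟨q, hq, hqm⟩, hub⟩ := hη.2.2 φ hφ
    obtain ⟨-, L, hL⟩ := hφ
    obtain ⟨R, hR⟩ := hΓ.1.2.1.exists_norm_le
    have hcpt : IsCompact Γ := Metric.isCompact_of_isClosed_isBounded hΓ.1.2.2.2 hΓ.1.2.1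
    refine tendsto_of_forall_abs_sub_le (L := L)
      (tendsto_average_rate ha_lim (2 * (M + 1 + R)) (2 * M + 2 * R ^ 2)) fun ε hε n hn => ?_
    have hX := SublinearExpectationSpace.IsRandomVector.sum_range hY n
    have hup := SublinearExpectationSpace.E_comp_average_le hX hΓ.1.1 hcpt hL
      (fun q hq => hub ⟨q, hq, rfl⟩) hε hn
    have hlow := SublinearExpectationSpace.le_E_comp_average hX hL q hε hn
    have hc : 0 ≤ L ^ 2 / (4 * ε) := by positivity
    have h1 := mul_le_mul_of_nonneg_left (div_le_div_of_nonneg_right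
      (SublinearExpectationSpace.E_infDist_sum_range_sq_le hY hindep hM.le hmoment
        (fun n => (ha n).le) hg hΓ hR n) (sq_nonneg (n : ℝ))) hc
    have h2 := mul_le_mul_of_nonneg_left (div_le_div_of_nonneg_right
      (SublinearExpectationSpace.neg_E_neg_norm_sum_range_sub_sq_le hY hindep hM.le hmoment
        (fun n => (ha n).le) hg (fun p => (hΓ.2 p).1 ⟨q, hq, rfl⟩) (hR q hq) n)
        (sq_nonneg (n : ℝ))) hc
    rw [abs_le]
    constructor <;> linarith
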